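/- Let $d,m\ge 0$ and $n\ge 1$ be integers, and let $D$ be a Borel probability measure on $\mathbb{R}^d$ that is balanced about some point $p\in\mathbb{R}^d$, in the sense that every hyperplane through $p$ partitions $D$ into two sets of equal measure: both open half-spaces bounded by the hyperplane have $D$-measure $1/2$. (If $D$ is absolutely continuous with respect to Lebesgue measure, this just says that the two sides of every hyperplane through $p$ have equal measure.) Let $(X_{i,j})_{1\le i\le m,\,1\le j\le n}$ be independent random points with distribution $D$, where $X_{i,j}$ is the $j$-th point of colour $i$, and call this random equi-partitioned point set *Tverberg* if the convex hulls of the $m$ colour classes have a common point, i.e. $\bigcap_{i=1}^m \operatorname{conv}\{X_{i,1},\dots,X_{i,n}\}\neq\varnothing$ (for $m=0$ the intersection is all of $\mathbb{R}^d$). Then $$\left(1-\frac{1}{2^{n-1}}\sum_{k=0}^{d-1}\binom{n-1}{k}\right)^m\;\le\;\mathbb{P}\bigl((X_{i,j})\text{ is Tverberg}\bigr)\;\le\;\Bigl(2(1-2^{-n})^m-(1-2^{-n+1})^m\Bigr)^d .$$ -/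

import Mathlib

open MeasureTheory

/-- `D` is balanced about `p`: every hyperplane `{x | ⟪v, x - p⟫ = 0}` through `p` (`v ≠ 0`) splits
`D` into two sets of equal measure, i.e. each of its two open sides has measure `1 / 2`. In particular
a hyperplane through `p` carries no mass. -/
def BalancedAbout {d : ℕ} (D : Measure (EuclideanSpace ℝ (Fin d)))
    (p : EuclideanSpace ℝ (Fin d)) : Prop :=
  ∀ v : EuclideanSpace ℝ (Fin d), v ≠ 0 →
    D {x | 0 < inner ℝ v (x - p)} = 1 / 2 ∧ D {x | inner ℝ v (x - p) < 0} = 1 / 2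

/-- An `m`-coloured family of points, `x (i, j)` being the `j`-th point of colour `i`, is Tverberg
if the convex hulls of its `m` colour classes have a common point. -/
def IsTverberg {d m n : ℕ} (x : Fin m × Fin n → EuclideanSpace ℝ (Fin d)) : Prop :=
  (⋂ i : Fin m, convexHull ℝ (Set.range fun j : Fin n => x (i, j))).Nonempty

/-- The law of the random equi-partitioned point set: `m` colours, `n` points of each colour, all
`m * n` points independent with distribution `D`. -/
noncomputable def equiPartitionLaw {d : ℕ} (m n : ℕ) (D : Measure (EuclideanSpace ℝ (Fin d))) :
    Measure (Fin m × Fin n → EuclideanSpace ℝ (Fin d)) :=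
  Measure.pi fun _ => D

/-!
Replacing `D` by the law `μ` of the direction `(X - p) / ‖X - p‖` changes neither the event that `p`
lies in the hull of a class nor the separation events below, so both bounds reduce to a statement
about `μ`, which gives mass `1 / 2` to every open half-space bounded by a hyperplane through `0`.

*Symmetry.* Such a `μ`, carried by the unit sphere, is invariant under `x ↦ -x`
(`map_neg_eq_self_of_balanced`). Averaging `∫ sign ⟪v, x⟫ ∂μ = 0` over `v` distributed as a Gaussian
centred at `t • w` gives `∫ Φ (t * ⟪w, x⟫) ∂μ = 0` for all `t`, with `Φ` an entire odd function all
of whose odd Taylor coefficients are nonzero. Hence the odd moments of `⟪w, x⟫` vanish, the integral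
of `sin ⟪w, x⟫` vanishes, and the characteristic functions of `μ` and of its reflection agree.

*Universality.* Consider the event that linear inequalities `0 < ⟪x i, φ i w⟫`, `i ∈ I`, have a
common solution `w` in a subspace `W`. By symmetry its probability is an average over all choices of
signs, and the number of sign vectors that admit a solution is determined, by deletion and
restriction, by the dimensions of the intersections of the hyperplanes `⟪x i, φ i w⟫ = 0`
(`two_pow_mul_sum_ite_exists_pos`). Since no hyperplane through `0` has mass, these dimensions are
almost surely the least possible ones (`ae_finrank_commonKer_eq`). So the probability is the same for
all symmetric laws that do not charge hyperplanes through `0` (`measureReal_posSolvable`).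

*Lower bound.* For one colour class this yields the classical formula for the probability that `n`
points lie in an open half-space through `0` (`measureReal_exists_forall_inner_pos`). A class which
does not lie in such a half-space has `p` in its hull, and the classes are independent.

*Upper bound.* If some nonempty set of classes lies in open half-spaces through `p` whose normals
sum to zero, the hulls have no common point. By inclusion-exclusion over the classes that lie in some
open half-space, the probability of this separation event is universal as well
(`measureReal_exists_separatedOn_congr`), so it may be computed for the standard Gaussian law. If
there is no separation then in each coordinate either no class is strictly negative or no class is
strictly positive; the coordinates of a Gaussian are independent, so the probability of this
is the `d`-th power of a one-dimensional one.
-/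

/-! ### Regions of hyperplane arrangements -/

open Filter Topology in
theorem exists_pos_add_smul {ι V : Type*} [AddCommGroup V] [Module ℝ V]
    (g : ι → V →ₗ[ℝ] ℝ) (I : Finset ι) (w u : V) (hw : ∀ i ∈ I, 0 < g i w) :
    ∃ t : ℝ, 0 < t ∧ ∀ i ∈ I, 0 < g i (w + t • u) := by
  have h : ∀ᶠ t in 𝓝[>] (0 : ℝ), ∀ i ∈ I, 0 < g i (w + t • u) := by
    rw [eventually_all_finset]
    intro i hi
    have hc : Continuous fun t : ℝ => g i (w + t • u) := by
      simp only [map_add, map_smul, smul_eq_mul]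
      fun_prop
    exact (hc.tendsto' 0 (g i w) (by simp)).eventually (lt_mem_nhds (hw i hi))
      |>.filter_mono nhdsWithin_le_nhds
  obtain ⟨t, ht, ht0⟩ := (h.and self_mem_nhdsWithin).exists
  exact ⟨t, ht0, ht⟩

open Classical in
/-- A nonempty open convex cone in `W` is either cut by the hyperplane `ker h` into two parts, and then
meets it, or lies on one side of it. -/
theorem ite_exists_pos_add_ite_exists_neg {ι V : Type*} [AddCommGroup V] [Module ℝ V]
    (g : ι → V →ₗ[ℝ] ℝ) (I : Finset ι) (W : Submodule ℝ V) (h : V →ₗ[ℝ] ℝ)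
    (hW : ¬ W ≤ LinearMap.ker h) :
    ((if ∃ w ∈ W, 0 < h w ∧ ∀ i ∈ I, 0 < g i w then 1 else 0) +
      (if ∃ w ∈ W, h w < 0 ∧ ∀ i ∈ I, 0 < g i w then 1 else 0) : ℝ) =
    (if ∃ w ∈ W, ∀ i ∈ I, 0 < g i w then 1 else 0) +
      (if ∃ w ∈ W ⊓ LinearMap.ker h, ∀ i ∈ I, 0 < g i w then 1 else 0) := by
  have hu : ∃ u ∈ W, 0 < h u := by
    obtain ⟨u, huW, hu⟩ := SetLike.not_le_iff_exists.1 hW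
    rcases lt_or_gt_of_ne (show h u ≠ 0 from hu) with h' | h'
    · exact ⟨-u, W.neg_mem huW, by simpa using h'⟩
    · exact ⟨u, huW, h'⟩
  obtain ⟨u, huW, hu⟩ := hu
  have hz : (∃ w ∈ W ⊓ LinearMap.ker h, ∀ i ∈ I, 0 < g i w) ↔
      (∃ w ∈ W, 0 < h w ∧ ∀ i ∈ I, 0 < g i w) ∧ (∃ w ∈ W, h w < 0 ∧ ∀ i ∈ I, 0 < g i w) := by
    constructor
    · rintro ⟨w, ⟨hwW, hw0⟩, hw⟩
      replace hw0 : h w = 0 := hw0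
      obtain ⟨t, ht, ht'⟩ := exists_pos_add_smul g I w u hw
      obtain ⟨r, hr, hr'⟩ := exists_pos_add_smul g I w (-u) hw
      refine ⟨⟨_, W.add_mem hwW (W.smul_mem t huW), ?_, ht'⟩,
        ⟨_, W.add_mem hwW (W.smul_mem r (W.neg_mem huW)), ?_, hr'⟩⟩
      · simp [hw0]; positivity
      · simp [hw0]; positivity
    · rintro ⟨⟨a, haW, ha0, ha⟩, ⟨b, hbW, hb0, hb⟩⟩
      refine ⟨(-h b) • a + h a • b, ⟨W.add_mem (W.smul_mem _ haW) (W.smul_mem _ hbW), ?_⟩, ?_⟩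
      · simp; ring
      · intro i hi
        have h1 := mul_pos (neg_pos.2 hb0) (ha i hi)
        have h2 := mul_pos ha0 (hb i hi)
        simp only [map_add, map_smul, smul_eq_mul]
        linarith
  have ho : (∃ w ∈ W, ∀ i ∈ I, 0 < g i w) ↔
      (∃ w ∈ W, 0 < h w ∧ ∀ i ∈ I, 0 < g i w) ∨ (∃ w ∈ W, h w < 0 ∧ ∀ i ∈ I, 0 < g i w) := by
    constructor
    · rintro ⟨w, hwW, hw⟩
      rcases lt_trichotomy (h w) 0 with h' | h' | h'
      · exact Or.inr ⟨w, hwW, h', hw⟩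
      · exact Or.inl (hz.1 ⟨w, ⟨hwW, h'⟩, hw⟩).1
      · exact Or.inl ⟨w, hwW, h', hw⟩
    · rintro (⟨w, hwW, -, hw⟩ | ⟨w, hwW, -, hw⟩) <;> exact ⟨w, hwW, hw⟩
  rw [if_congr hz rfl rfl, if_congr ho rfl rfl]
  by_cases hp : ∃ w ∈ W, 0 < h w ∧ ∀ i ∈ I, 0 < g i w <;>
    by_cases hn : ∃ w ∈ W, h w < 0 ∧ ∀ i ∈ I, 0 < g i w <;>
    norm_num [hp, hn]

theorem finrank_inf_ker_add_one {V : Type*} [AddCommGroup V] [Module ℝ V] [FiniteDimensional ℝ V]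
    (W : Submodule ℝ V) (h : V →ₗ[ℝ] ℝ) (hW : ¬ W ≤ LinearMap.ker h) :
    Module.finrank ℝ ↥(W ⊓ LinearMap.ker h) + 1 = Module.finrank ℝ W := by
  have hne : h.domRestrict W ≠ 0 := by
    intro h0
    apply hW
    intro w hw
    exact LinearMap.congr_fun h0 ⟨w, hw⟩
  have := Module.Dual.finrank_ker_add_one_of_ne_zero (f := h.domRestrict W) hne
  rw [← this, LinearMap.ker_domRestrict, ← Submodule.finrank_map_subtype_eq,
    Submodule.map_comap_subtype]

open Classical in
/-- Counts the sign vectors `s` for which the inequalities `0 < s i * f i w`, `i ∈ I`, are solvable in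
`W`. For `I` the whole index set this is the number of regions of a central hyperplane arrangement
in Whitney's form. The signs `s i` with `i ∉ I` are free, which accounts for the powers of two. -/
theorem two_pow_mul_sum_ite_exists_pos {ι V : Type*} [Fintype ι] [DecidableEq ι]
    [AddCommGroup V] [Module ℝ V] [FiniteDimensional ℝ V]
    (f : ι → V →ₗ[ℝ] ℝ) (I : Finset ι) (W : Submodule ℝ V) :
    (2 : ℝ) ^ I.card * ∑ s : ι → ℤˣ,
        (if ∃ w ∈ W, ∀ i ∈ I, 0 < ((s i : ℤ) : ℝ) * f i w then 1 else 0) =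
      2 ^ Fintype.card ι * ∑ B ∈ I.powerset, (-1) ^ (B.card + Module.finrank ℝ W +
        Module.finrank ℝ ↥(W ⊓ ⨅ b ∈ B, LinearMap.ker (f b))) := by
  induction I using Finset.induction_on generalizing W with
  | empty =>
    have : ∃ w, w ∈ W := ⟨0, W.zero_mem⟩
    have hW : W ⊓ ⨅ b ∈ (∅ : Finset ι), LinearMap.ker (f b) = W := by simp
    rw [Finset.powerset_empty, Finset.sum_singleton, hW]
    simp [this, Fintype.card_pi, ← two_mul]
  | insert j I hj ih =>
    rw [Finset.card_insert_of_notMem hj, Finset.sum_powerset_insert hj]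
    by_cases hW : W ≤ LinearMap.ker (f j)
    · have h1 : ∀ s : ι → ℤˣ,
          ¬ ∃ w ∈ W, ∀ i ∈ insert j I, 0 < ((s i : ℤ) : ℝ) * f i w := by
        rintro s ⟨w, hw, h⟩
        have := h j (Finset.mem_insert_self _ _)
        rw [show f j w = 0 from hW hw] at this
        simp at this
      simp only [h1, if_false, Finset.sum_const_zero, mul_zero]
      rw [← Finset.sum_add_distrib, Finset.sum_eq_zero, mul_zero]
      intro B hB
      have hjB : j ∉ B := fun h => hj (Finset.mem_powerset.1 hB h)
      rw [Finset.card_insert_of_notMem hjB, Finset.iInf_insert, ← inf_assoc, inf_eq_left.2 hW]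
      ring
    -- Flipping the sign of `j` pairs the sign vectors: the solvable systems in a pair are as many
    -- as those among the deletion of `j` and the restriction to `ker (f j)`.
    · let e : (ι → ℤˣ) ≃ (ι → ℤˣ) := Function.Involutive.toPerm
        (fun s => Function.update s j (-s j)) (fun s => by simp)
      have key : ∀ s : ι → ℤˣ,
          ((if ∃ w ∈ W, ∀ i ∈ insert j I, 0 < ((s i : ℤ) : ℝ) * f i w then 1 else 0) +
          (if ∃ w ∈ W, ∀ i ∈ insert j I, 0 < ((e s i : ℤ) : ℝ) * f i w then 1 else 0) : ℝ) =
          (if ∃ w ∈ W, ∀ i ∈ I, 0 < ((s i : ℤ) : ℝ) * f i w then 1 else 0) +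
          (if ∃ w ∈ W ⊓ LinearMap.ker (f j), ∀ i ∈ I, 0 < ((s i : ℤ) : ℝ) * f i w
            then 1 else 0) := by
        intro s
        have := ite_exists_pos_add_ite_exists_neg
          (fun i => (((s i : ℤ) : ℝ)) • f i) I W (f j) hW
        simp only [LinearMap.smul_apply, smul_eq_mul] at this
        rw [← this]
        have h2 : ∀ w, (∀ i ∈ I, 0 < ((e s i : ℤ) : ℝ) * f i w) ↔
            ∀ i ∈ I, 0 < ((s i : ℤ) : ℝ) * f i w := by
          intro w
          refine forall₂_congr fun i hi => ?_
          have hij : i ≠ j := fun h => hj (h ▸ hi)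
          simp [e, Function.Involutive.toPerm, hij]
        have h3 : e s j = - s j := by simp [e, Function.Involutive.toPerm]
        simp only [Finset.forall_mem_insert, h2, h3]
        rcases Int.units_eq_one_or (s j) with h | h
        · simp [h]
        · simp only [h]
          rw [add_comm]
          simp
      have hsum : 2 * ∑ s : ι → ℤˣ,
          (if ∃ w ∈ W, ∀ i ∈ insert j I, 0 < ((s i : ℤ) : ℝ) * f i w then (1 : ℝ) else 0) =
          ∑ s : ι → ℤˣ, (if ∃ w ∈ W, ∀ i ∈ I, 0 < ((s i : ℤ) : ℝ) * f i w then (1 : ℝ) else 0) +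
          ∑ s : ι → ℤˣ, (if ∃ w ∈ W ⊓ LinearMap.ker (f j), ∀ i ∈ I, 0 < ((s i : ℤ) : ℝ) * f i w
            then (1 : ℝ) else 0) := by
        rw [← Finset.sum_add_distrib, ← Finset.sum_congr rfl fun s _ => key s,
          Finset.sum_add_distrib, two_mul]
        congr 1
        exact (Equiv.sum_comp e _).symm
      rw [pow_succ, mul_assoc, hsum, mul_add, ih W, ih (W ⊓ LinearMap.ker (f j)), mul_add]
      congr 2
      refine Finset.sum_congr rfl fun B hB => ?_
      have hjB : j ∉ B := fun h => hj (Finset.mem_powerset.1 hB h)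
      rw [Finset.card_insert_of_notMem hjB, Finset.iInf_insert, ← inf_assoc,
        ← finrank_inf_ker_add_one W (f j) hW]
      ring

/-! ### General position and universality -/

/-- A property holds almost surely for a product measure as soon as it holds almost surely after
resampling one coordinate, whatever the others are. -/
theorem ae_pi_of_forall_ae_update {ι : Type*} [Fintype ι] [DecidableEq ι] {α : ι → Type*}
    [∀ i, MeasurableSpace (α i)] (μ : ∀ i, Measure (α i)) [∀ i, IsProbabilityMeasure (μ i)]
    {P : (∀ i, α i) → Prop} (hP : MeasurableSet {x | P x}) (j : ι)
    (h : ∀ x, ∀ᵐ z ∂μ j, P (Function.update x j z)) : ∀ᵐ x ∂Measure.pi μ, P x := by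
  rcases isEmpty_or_nonempty (∀ i, α i) with he | ⟨⟨x₀⟩⟩
  · exact Filter.Eventually.of_forall fun x => he.elim x
  rw [ae_iff, show {x | ¬ P x} = {x | P x}ᶜ from rfl, ← lintegral_indicator_one hP.compl,
    lintegral_eq_lmarginal_univ x₀]
  have hf : Measurable (({x | P x}ᶜ : Set (∀ i, α i)).indicator (1 : (∀ i, α i) → ENNReal)) :=
    measurable_one.indicator hP.compl
  rw [← Finset.insert_erase (Finset.mem_univ j), lmarginal_insert' _ hf (Finset.notMem_erase j _)]
  have : (fun x : ∀ i, α i => ∫⁻ z, ({x | P x}ᶜ : Set (∀ i, α i)).indicator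
      (1 : (∀ i, α i) → ENNReal) (Function.update x j z) ∂μ j) = 0 := by
    funext x
    refine (lintegral_eq_zero_iff (hf.comp (measurable_update x))).2 ?_
    filter_upwards [h x] with z hz
    simp [hz]
  rw [this]
  simp [lmarginal]

section generic

variable {ι E V : Type*} [NormedAddCommGroup E] [InnerProductSpace ℝ E]
  [AddCommGroup V] [Module ℝ V]

/-- The linear functional `w ↦ ⟪x i, φ i w⟫`. -/
noncomputable def pairing (φ : ι → V →ₗ[ℝ] E) (x : ι → E) (i : ι) : V →ₗ[ℝ] ℝ :=
  (innerₗ E (x i)) ∘ₗ φ i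

@[simp] theorem pairing_apply (φ : ι → V →ₗ[ℝ] E) (x : ι → E) (i : ι) (w : V) :
    pairing φ x i w = inner ℝ (x i) (φ i w) := rfl

/-- The subspace of those `w ∈ W` annihilated by all the functionals `pairing φ x b`, `b ∈ B`. -/
noncomputable def commonKer (φ : ι → V →ₗ[ℝ] E) (W : Submodule ℝ V) (B : Finset ι) (x : ι → E) :
    Submodule ℝ V :=
  W ⊓ ⨅ b ∈ B, LinearMap.ker (pairing φ x b)

theorem mem_commonKer {φ : ι → V →ₗ[ℝ] E} {W : Submodule ℝ V} {B : Finset ι} {x : ι → E} {w : V} :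
    w ∈ commonKer φ W B x ↔ w ∈ W ∧ ∀ b ∈ B, inner ℝ (x b) (φ b w) = 0 := by
  simp [commonKer, Submodule.mem_iInf]

/-- The rank of finitely many functionals is lower semicontinuous in the points `x`. -/
theorem isOpen_setOf_finrank_commonKer_le [FiniteDimensional ℝ V] (φ : ι → V →ₗ[ℝ] E)
    (W : Submodule ℝ V) (B : Finset ι) (k : ℕ) :
    IsOpen {x : ι → E | Module.finrank ℝ (commonKer φ W B x) ≤ k} := by
  let A : (ι → E) → W →ₗ[ℝ] (B → ℝ) := fun x =>
    (LinearMap.pi fun b : B => pairing φ x b).domRestrict W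
  have hA : ∀ x, Module.finrank ℝ (LinearMap.range (A x)) +
      Module.finrank ℝ (commonKer φ W B x) = Module.finrank ℝ W := by
    intro x
    rw [← LinearMap.finrank_range_add_finrank_ker (A x), commonKer, LinearMap.ker_domRestrict,
      ← Submodule.finrank_map_subtype_eq W, Submodule.map_comap_subtype, LinearMap.ker_pi,
      iInf_subtype]
  rw [isOpen_iff_forall_mem_open]
  intro x₀ hx₀
  let c := Module.finBasis ℝ (LinearMap.range (A x₀))
  have hb : ∀ k, ∃ w : W, A x₀ w = c k := fun k => (c k).2
  choose b hb using hb
  refine ⟨{x | LinearIndependent ℝ fun k => A x (b k)}, ?_, ?_, ?_⟩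
  · intro x hx
    have h1 := LinearIndependent.of_comp (LinearMap.range (A x)).subtype
      (v := fun k => (⟨A x (b k), LinearMap.mem_range_self _ _⟩ : LinearMap.range (A x))) hx
    have h2 := h1.fintype_card_le_finrank
    rw [Fintype.card_fin] at h2
    have h3 := hA x
    have h4 := hA x₀
    simp only [Set.mem_ofPred_eq] at hx₀ ⊢
    omega
  · refine isOpen_setOfPred_linearIndependent.preimage (f := fun x k => A x (b k)) ?_
    refine continuous_pi fun k => continuous_pi fun i => ?_
    change Continuous fun x : ι → E => inner ℝ (x i) (φ i (b k))
    fun_prop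
  · have : (fun k => A x₀ (b k)) = (LinearMap.range (A x₀)).subtype ∘ c := by
      funext k; simp [hb]
    rw [Set.mem_ofPred_eq, this]
    exact c.linearIndependent.map' _ (Submodule.ker_subtype _)

/-- The points `x` for which the open half-spaces `0 < ⟪x i, φ i w⟫`, `i ∈ I`, have a common
point `w` in the subspace `W`. -/
def posSolvable (φ : ι → V →ₗ[ℝ] E) (W : Submodule ℝ V) (I : Finset ι) : Set (ι → E) :=
  {x | ∃ w ∈ W, ∀ i ∈ I, 0 < inner ℝ (x i) (φ i w)}

theorem isOpen_posSolvable (φ : ι → V →ₗ[ℝ] E) (W : Submodule ℝ V) (I : Finset ι) :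
    IsOpen (posSolvable φ W I) := by
  have : posSolvable φ W I = ⋃ w ∈ W, ⋂ i ∈ I, {x : ι → E | 0 < inner ℝ (x i) (φ i w)} := by
    ext x; simp [posSolvable]
  rw [this]
  refine isOpen_biUnion fun w _ => isOpen_biInter_finset fun i _ => ?_
  exact isOpen_lt continuous_const (by fun_prop)

variable [MeasurableSpace E] [DecidableEq ι]

/-- Replacing one point by a random one almost surely does not increase the dimension: the new
functional vanishes on the intersection of the other kernels only if every choice of the point would
make it vanish there. -/
theorem ae_finrank_commonKer_update_le [FiniteDimensional ℝ V] (φ : ι → V →ₗ[ℝ] E)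
    (W : Submodule ℝ V) (B : Finset ι) {μ : Measure E}
    (hμ : ∀ v : E, v ≠ 0 → ∀ᵐ z ∂μ, inner ℝ z v ≠ 0) (y : ι → E) (j : ι) :
    ∀ᵐ z ∂μ, Module.finrank ℝ (commonKer φ W B (Function.update y j z)) ≤
      Module.finrank ℝ (commonKer φ W B y) := by
  by_cases hj : j ∈ B
  swap
  · refine Filter.Eventually.of_forall fun z => le_of_eq ?_
    have : commonKer φ W B (Function.update y j z) = commonKer φ W B y := by
      ext w
      simp only [mem_commonKer]
      refine and_congr_right fun _ => forall₂_congr fun b hb => ?_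
      rw [Function.update_of_ne (ne_of_mem_of_not_mem hb hj)]
    rw [this]
  let U := commonKer φ W (B.erase j) y
  let h : E → V →ₗ[ℝ] ℝ := fun z => (innerₗ E z) ∘ₗ φ j
  have hU : ∀ z, commonKer φ W B (Function.update y j z) = U ⊓ LinearMap.ker (h z) := by
    intro z
    ext w
    rw [← Finset.insert_erase hj]
    simp only [U, h, Submodule.mem_inf, mem_commonKer, Finset.forall_mem_insert,
      Function.update_self, LinearMap.mem_ker, LinearMap.comp_apply, innerₗ_apply_apply]
    have : (∀ b ∈ B.erase j, inner ℝ (Function.update y j z b) (φ b w) = 0) ↔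
        ∀ b ∈ B.erase j, inner ℝ (y b) (φ b w) = 0 :=
      forall₂_congr fun b hb => by rw [Function.update_of_ne (Finset.ne_of_mem_erase hb)]
    rw [this]
    tauto
  have hy : commonKer φ W B y = U ⊓ LinearMap.ker (h (y j)) := by
    rw [← hU, Function.update_eq_self]
  by_cases h0 : ∀ w ∈ U, φ j w = 0
  · refine Filter.Eventually.of_forall fun z => ?_
    have : ∀ z, U ⊓ LinearMap.ker (h z) = U := fun z =>
      inf_eq_left.2 fun w hw => by simp [h, h0 w hw]
    rw [hU, hy, this, this]
  · push Not at h0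
    obtain ⟨w, hwU, hw⟩ := h0
    filter_upwards [hμ _ hw] with z hz
    rw [hU, hy]
    have h1 := finrank_inf_ker_add_one U (h z) fun hle => hz (hle hwU)
    by_cases h2 : U ≤ LinearMap.ker (h (y j))
    · rw [inf_eq_left.2 h2]; omega
    · have := finrank_inf_ker_add_one U (h (y j)) h2
      omega

variable [BorelSpace E] [SecondCountableTopology E] [Fintype ι]

/-- Independent random points are in general position: no configuration `y` has a smaller common
kernel. The points of `y` are replaced by random ones one at a time. -/
theorem ae_finrank_commonKer_le [FiniteDimensional ℝ V] (φ : ι → V →ₗ[ℝ] E)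
    (W : Submodule ℝ V) (B : Finset ι) {μ : Measure E} [IsProbabilityMeasure μ]
    (hμ : ∀ v : E, v ≠ 0 → ∀ᵐ z ∂μ, inner ℝ z v ≠ 0) (y : ι → E) :
    ∀ᵐ x ∂Measure.pi fun _ : ι => μ, Module.finrank ℝ (commonKer φ W B x) ≤
      Module.finrank ℝ (commonKer φ W B y) := by
  suffices H : ∀ J : Finset ι, ∀ᵐ x ∂Measure.pi fun _ : ι => μ,
      Module.finrank ℝ (commonKer φ W B (J.piecewise x y)) ≤
        Module.finrank ℝ (commonKer φ W B y) by
    filter_upwards [H Finset.univ] with x hx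
    rwa [Finset.piecewise_univ] at hx
  intro J
  induction J using Finset.induction_on with
  | empty =>
    refine Filter.Eventually.of_forall fun x => ?_
    rw [Finset.piecewise_empty]
  | insert j J hj ih =>
    have hm : ∀ J : Finset ι, Measurable fun x : ι → E =>
        Module.finrank ℝ (commonKer φ W B (J.piecewise x y)) := by
      intro J
      have h1 : Measurable fun x : ι → E => Module.finrank ℝ (commonKer φ W B x) :=
        measurable_of_Iic fun k => (isOpen_setOf_finrank_commonKer_le φ W B k).measurableSet
      refine h1.comp (measurable_pi_lambda _ fun i => ?_)
      by_cases hi : i ∈ J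
      · simpa [hi] using measurable_pi_apply i
      · simp [hi]
    have key : ∀ᵐ x ∂Measure.pi fun _ : ι => μ,
        Module.finrank ℝ (commonKer φ W B ((insert j J).piecewise x y)) ≤
          Module.finrank ℝ (commonKer φ W B (J.piecewise x y)) := by
      refine ae_pi_of_forall_ae_update (fun _ => μ) (measurableSet_le (hm _) (hm _)) j fun x => ?_
      filter_upwards [ae_finrank_commonKer_update_le φ W B hμ (J.piecewise x y) j] with z hz
      rw [Finset.piecewise_insert, Function.update_self]
      have : J.piecewise (Function.update x j z) y = J.piecewise x y := by
        funext i
        by_cases hi : i ∈ J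
        · have : i ≠ j := fun h => hj (h ▸ hi)
          simp [hi, this]
        · simp [hi]
      rwa [this]
    filter_upwards [key, ih] with x h1 h2 using h1.trans h2

/-- The dimension of `commonKer φ W B x` for points `x` in general position, defined as the least
value it takes. -/
noncomputable def genericFinrank (φ : ι → V →ₗ[ℝ] E) (W : Submodule ℝ V) (B : Finset ι) : ℕ :=
  ⨅ x : ι → E, Module.finrank ℝ (commonKer φ W B x)

theorem ae_finrank_commonKer_eq [FiniteDimensional ℝ V] (φ : ι → V →ₗ[ℝ] E)
    (W : Submodule ℝ V) (B : Finset ι) {μ : Measure E} [IsProbabilityMeasure μ]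
    (hμ : ∀ v : E, v ≠ 0 → ∀ᵐ z ∂μ, inner ℝ z v ≠ 0) :
    ∀ᵐ x ∂Measure.pi fun _ : ι => μ,
      Module.finrank ℝ (commonKer φ W B x) = genericFinrank φ W B := by
  obtain ⟨y, hy⟩ : ∃ y : ι → E, Module.finrank ℝ (commonKer φ W B y) = genericFinrank φ W B :=
    Nat.sInf_mem (Set.range_nonempty _)
  filter_upwards [ae_finrank_commonKer_le φ W B hμ y] with x hx
  exact le_antisymm (hx.trans_eq hy) (Nat.sInf_le ⟨x, rfl⟩)

/-- The probability that random half-spaces have a common point in `W` depends on the law `μ` of the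
points only through its symmetry and the vanishing of its mass on hyperplanes through `0`. -/
theorem measureReal_posSolvable [FiniteDimensional ℝ V] (φ : ι → V →ₗ[ℝ] E)
    (W : Submodule ℝ V) (I : Finset ι) {μ : Measure E} [IsProbabilityMeasure μ]
    (hμ : ∀ v : E, v ≠ 0 → ∀ᵐ z ∂μ, inner ℝ z v ≠ 0) (hs : μ.map (fun z => -z) = μ) :
    (Measure.pi fun _ : ι => μ).real (posSolvable φ W I) =
      (1 / 2) ^ I.card * ∑ B ∈ I.powerset,
        (-1) ^ (B.card + Module.finrank ℝ W + genericFinrank φ W B) := by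
  classical
  set P := Measure.pi fun _ : ι => μ
  let F : (ι → ℤˣ) → (ι → E) → (ι → E) := fun s x i => ((s i : ℤ) : ℝ) • x i
  have hF : ∀ s, MeasurePreserving (F s) P P := by
    intro s
    refine measurePreserving_pi (fun _ => μ) (fun _ => μ) (f := fun i z => ((s i : ℤ) : ℝ) • z)
      fun i => ⟨by fun_prop, ?_⟩
    rcases Int.units_eq_one_or (s i) with h | h
    · simp [h]
    · simpa [h] using hs
  have hmeas : MeasurableSet (posSolvable φ W I) := (isOpen_posSolvable φ W I).measurableSet
  have h1 : ∀ s, P.real (F s ⁻¹' posSolvable φ W I) = P.real (posSolvable φ W I) := fun s =>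
    (hF s).measureReal_preimage hmeas.nullMeasurableSet
  have h2 : (2 : ℝ) ^ Fintype.card ι * P.real (posSolvable φ W I) =
      ∫ x, ∑ s, (F s ⁻¹' posSolvable φ W I).indicator 1 x ∂P := by
    rw [integral_finsetSum _ fun s _ =>
      (integrable_const 1).indicator ((hF s).measurable hmeas)]
    simp_rw [integral_indicator_one ((hF _).measurable hmeas), h1]
    simp [Fintype.card_pi]
  have h3 : ∀ᵐ x ∂P, ∑ s, (F s ⁻¹' posSolvable φ W I).indicator (1 : (ι → E) → ℝ) x =
      2 ^ Fintype.card ι * ((1 / 2) ^ I.card * ∑ B ∈ I.powerset,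
        (-1) ^ (B.card + Module.finrank ℝ W + genericFinrank φ W B)) := by
    have h4 : ∀ᵐ x ∂P, ∀ B ∈ I.powerset,
        Module.finrank ℝ (commonKer φ W B x) = genericFinrank φ W B := by
      refine (ae_ball_iff (S := (I.powerset : Set (Finset ι))) (Finset.countable_toSet _)).2 ?_
      exact fun B _ => ae_finrank_commonKer_eq φ W B hμ
    filter_upwards [h4] with x hx
    have h5 := two_pow_mul_sum_ite_exists_pos (pairing φ x) I W
    have h6 : ∀ s, (F s ⁻¹' posSolvable φ W I).indicator (1 : (ι → E) → ℝ) x =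
        if ∃ w ∈ W, ∀ i ∈ I, 0 < ((s i : ℤ) : ℝ) * pairing φ x i w then 1 else 0 := by
      intro s
      simp only [Set.indicator_apply, Set.mem_preimage, posSolvable, Set.mem_ofPred_eq, F,
        inner_smul_left, pairing_apply, Pi.one_apply]
      rfl
    rw [Finset.sum_congr rfl fun s _ => h6 s]
    have h7 : ∀ B ∈ I.powerset, (-1 : ℝ) ^ (B.card + Module.finrank ℝ W +
        Module.finrank ℝ ↥(W ⊓ ⨅ b ∈ B, LinearMap.ker (pairing φ x b))) =
        (-1) ^ (B.card + Module.finrank ℝ W + genericFinrank φ W B) := fun B hB => by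
      rw [← hx B hB]; rfl
    rw [Finset.sum_congr rfl h7] at h5
    rw [mul_left_comm, ← h5, ← mul_assoc, ← mul_pow]
    norm_num
  rw [integral_congr_ae h3] at h2
  simpa using h2

end generic

/-! ### Balanced measures on the sphere are symmetric -/

section symmetry

open ProbabilityTheory Filter Topology

theorem measurable_realSign : Measurable Real.sign := by
  unfold Real.sign
  exact Measurable.ite measurableSet_Iio measurable_const
    (Measurable.ite measurableSet_Ioi measurable_const measurable_const)

theorem norm_realSign_le_one (r : ℝ) : ‖Real.sign r‖ ≤ 1 := by
  rcases Real.sign_apply_eq r with h | h | h <;> simp [h]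

theorem integrable_realSign_comp {Ω : Type*} [MeasurableSpace Ω] {μ : Measure Ω}
    [IsFiniteMeasure μ] {f : Ω → ℝ} (hf : Measurable f) :
    Integrable (fun x => Real.sign (f x)) μ :=
  Integrable.of_bound (measurable_realSign.comp hf).aestronglyMeasurable 1
    (Eventually.of_forall fun x => norm_realSign_le_one (f x))

theorem integral_realSign_comp {Ω : Type*} [MeasurableSpace Ω] {μ : Measure Ω}
    [IsFiniteMeasure μ] {f : Ω → ℝ} (hf : Measurable f) :
    ∫ x, Real.sign (f x) ∂μ = μ.real {x | 0 < f x} - μ.real {x | f x < 0} := by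
  have h1 : MeasurableSet {x | 0 < f x} := measurableSet_lt measurable_const hf
  have h2 : MeasurableSet {x | f x < 0} := measurableSet_lt hf measurable_const
  rw [← integral_indicator_one h1, ← integral_indicator_one h2,
    ← integral_sub ((integrable_const 1).indicator h1) ((integrable_const 1).indicator h2)]
  congr 1
  funext x
  rcases lt_trichotomy (f x) 0 with h | h | h
  · simp [Real.sign_of_neg h, h, h.le]
  · simp [h]
  · simp [Real.sign_of_pos h, h, h.le]

/-- The Taylor coefficient of order `2 * k + 1` of `s ↦ ∫ g, sign (g + s)` for a standard Gaussian
`g`. -/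
noncomputable def gaussSignCoeff (k : ℕ) : ℝ :=
  2 * (√(2 * Real.pi))⁻¹ * ((-1 / 2) ^ k / k.factorial / (2 * k + 1))

theorem gaussSignCoeff_ne_zero (k : ℕ) : gaussSignCoeff k ≠ 0 := by
  unfold gaussSignCoeff
  have : (2 * (k : ℝ) + 1) ≠ 0 := by positivity
  have : √(2 * Real.pi) ≠ 0 := by positivity
  have : (k.factorial : ℝ) ≠ 0 := by exact_mod_cast k.factorial_ne_zero
  have : ((-1 / 2 : ℝ)) ^ k ≠ 0 := pow_ne_zero _ (by norm_num)
  positivity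

theorem integral_realSign_add_gaussianReal (s : ℝ) :
    ∫ g, Real.sign (g + s) ∂gaussianReal 0 1 =
      2 * ∫ u in (-s)..0, gaussianPDFReal 0 1 u := by
  have hint := integrable_gaussianPDFReal 0 1
  have hI : ∀ s : ℝ, ∫ g, Real.sign (g + s) ∂gaussianReal 0 1 =
      1 - 2 * ∫ u in Set.Iic (-s), gaussianPDFReal 0 1 u := by
    intro s
    have h1 : ∀ᵐ g ∂gaussianReal 0 1,
        Real.sign (g + s) = 1 - 2 * (Set.Iic (-s)).indicator 1 g := by
      have : ∀ᵐ g ∂gaussianReal 0 1, g ≠ -s := by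
        have := nullSingletonClass_gaussianReal (μ := 0) (v := 1) one_ne_zero
        simp [ae_iff]
      filter_upwards [this] with g hg
      rcases lt_or_gt_of_ne hg with h | h
      · rw [Real.sign_of_neg (by linarith), Set.indicator_of_mem (Set.mem_Iic.2 h.le)]
        norm_num
      · rw [Real.sign_of_pos (by linarith), Set.indicator_of_notMem (by simpa using h)]
        norm_num
    have h2 : Integrable ((Set.Iic (-s)).indicator (1 : ℝ → ℝ)) (gaussianReal 0 1) :=
      (integrable_const (1 : ℝ)).indicator measurableSet_Iic
    rw [integral_congr_ae h1, integral_sub (integrable_const _) (h2.const_mul 2),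
      integral_const_mul,
      integral_indicator_one measurableSet_Iic, measureReal_def,
      gaussianReal_apply_eq_integral 0 one_ne_zero, ENNReal.toReal_ofReal
        (setIntegral_nonneg measurableSet_Iic fun x _ => gaussianPDFReal_nonneg 0 1 x)]
    simp
  have h0 : ∫ g, Real.sign (g + 0) ∂gaussianReal 0 1 = 0 := by
    have h1 : (gaussianReal 0 1).map (fun x => -x) = gaussianReal 0 1 := by
      simp [gaussianReal_map_neg]
    have h2 : ∫ g, Real.sign g ∂gaussianReal 0 1 = - ∫ g, Real.sign g ∂gaussianReal 0 1 := by
      conv_lhs => rw [← h1, integral_map (by fun_prop) measurable_realSign.aestronglyMeasurable]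
      simp [Real.sign_neg, integral_neg]
    simp only [add_zero]
    linarith
  rw [hI s]
  rw [hI 0, neg_zero] at h0
  rw [← intervalIntegral.integral_Iic_sub_Iic hint.integrableOn hint.integrableOn]
  linarith

theorem hasSum_integral_realSign_add_gaussianReal (s : ℝ) :
    HasSum (fun k : ℕ => gaussSignCoeff k * s ^ (2 * k + 1))
      (∫ g, Real.sign (g + s) ∂gaussianReal 0 1) := by
  rw [integral_realSign_add_gaussianReal]
  have h1 : HasSum (fun k : ℕ => ∫ u in (-s)..0, (-(u ^ 2) / 2) ^ k / (k.factorial : ℝ))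
      (∫ u in (-s)..0, Real.exp (-(u ^ 2) / 2)) := by
    refine intervalIntegral.hasSum_integral_of_dominated_convergence
      (fun k _ => (s ^ 2 / 2) ^ k / (k.factorial : ℝ)) (fun k => ?_) (fun k => ?_) ?_ ?_ ?_
    · exact Continuous.aestronglyMeasurable (by fun_prop)
    · refine Eventually.of_forall fun u hu => ?_
      have hu' : |u| ≤ |s| := by
        rw [Set.uIoc_comm] at hu
        have := Set.abs_sub_left_of_mem_uIcc (Set.uIoc_subset_uIcc hu)
        simpa using this
      have h2 : u ^ 2 ≤ s ^ 2 := sq_le_sq.2 hu'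
      rw [norm_div, norm_pow, Real.norm_natCast, norm_div, norm_neg, Real.norm_of_nonneg (sq_nonneg u),
        Real.norm_ofNat]
      gcongr
    · exact Eventually.of_forall fun u _ => Real.summable_pow_div_factorial _
    · exact intervalIntegrable_const
    · refine Eventually.of_forall fun u _ => ?_
      rw [Real.exp_eq_exp_ℝ]
      exact NormedSpace.expSeries_div_hasSum_exp _
  have h2 : ∫ u in (-s)..0, gaussianPDFReal 0 1 u =
      (√(2 * Real.pi))⁻¹ * ∫ u in (-s)..0, Real.exp (-(u ^ 2) / 2) := by
    simp [gaussianPDFReal]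
  rw [h2, ← mul_assoc]
  refine (h1.mul_left _).congr_fun ?_
  intro k
  have h3 : ∀ u : ℝ, (-(u ^ 2) / 2) ^ k / (k.factorial : ℝ) =
      ((-1 / 2) ^ k / (k.factorial : ℝ)) * u ^ (2 * k) := by
    intro u
    rw [pow_mul, show -(u ^ 2) / 2 = (-1 / 2) * u ^ 2 by ring, mul_pow]
    ring
  simp only [h3]
  rw [intervalIntegral.integral_const_mul, integral_pow, gaussSignCoeff,
    Odd.neg_pow ⟨k, rfl⟩, zero_pow (by omega)]
  push_cast
  ring

/-- An everywhere convergent odd power series may be integrated termwise along a bounded function. -/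
theorem hasSum_integral_odd_powers {Ω : Type*} [MeasurableSpace Ω] {μ : Measure Ω}
    [IsFiniteMeasure μ] {y : Ω → ℝ} (hy : Measurable y) {R : ℝ} (hR : ∀ᵐ x ∂μ, |y x| ≤ R)
    {a : ℕ → ℝ} {Φ : ℝ → ℝ} (hΦ : ∀ s, HasSum (fun k => a k * s ^ (2 * k + 1)) (Φ s)) :
    HasSum (fun k => a k * ∫ x, y x ^ (2 * k + 1) ∂μ) (∫ x, Φ (y x) ∂μ) := by
  simp only [← integral_const_mul]
  refine hasSum_integral_of_dominated_convergence (fun k _ => |a k * R ^ (2 * k + 1)|)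
    (fun k => ?_) (fun k => ?_) ?_ ?_ ?_
  · exact ((hy.pow_const _).const_mul _).aestronglyMeasurable
  · filter_upwards [hR] with x hx
    rw [Real.norm_eq_abs, abs_mul, abs_mul, abs_pow, abs_pow]
    exact mul_le_mul_of_nonneg_left
      (pow_le_pow_left₀ (abs_nonneg _) (hx.trans (le_abs_self R)) _) (abs_nonneg _)
  · exact Eventually.of_forall fun _ => (hΦ R).summable.abs
  · exact integrable_const _
  · exact Eventually.of_forall fun x => hΦ (y x)

theorem eq_zero_of_hasSum_odd_powers {b : ℕ → ℝ}
    (h : ∀ t : ℝ, HasSum (fun k => b k * t ^ (2 * k + 1)) 0) (k : ℕ) : b k = 0 := by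
  have hinj : Function.Injective fun k : ℕ => 2 * k + 1 := fun i j hij => by
    simp only at hij; omega
  let c : ℕ → ℝ := Function.extend (fun k : ℕ => 2 * k + 1) b 0
  have hc : ∀ t : ℝ, HasSum (fun n => t ^ n • c n) 0 := by
    intro t
    rw [← hinj.hasSum_iff]
    · refine (h t).congr_fun fun k => ?_
      have h3 : c (2 * k + 1) = b k := hinj.extend_apply b 0 k
      rw [Function.comp_apply, h3, smul_eq_mul, mul_comm]
    · intro n hn
      simp [c, Function.extend_apply' _ _ _ hn]
  have h1 : HasFPowerSeriesAt (0 : ℝ → ℝ) (FormalMultilinearSeries.ofScalars ℝ c) 0 := by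
    rw [hasFPowerSeriesAt_iff]
    exact Eventually.of_forall fun t => by simpa [FormalMultilinearSeries.coeff_ofScalars] using hc t
  have h2 : (FormalMultilinearSeries.ofScalars ℝ c).coeff (2 * k + 1) = c (2 * k + 1) := by
    simp [FormalMultilinearSeries.coeff_ofScalars]
  rw [h1.eq_zero] at h2
  have h3 : c (2 * k + 1) = b k := hinj.extend_apply b 0 k
  rw [← h3, ← h2]
  rfl

variable {E : Type*} [NormedAddCommGroup E] [InnerProductSpace ℝ E] [FiniteDimensional ℝ E]
  [MeasurableSpace E] [BorelSpace E]

theorem map_inner_stdGaussian (x : E) (hx : ‖x‖ = 1) :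
    (stdGaussian E).map (fun v => inner ℝ v x) = gaussianReal 0 1 := by
  have h := IsGaussian.map_eq_gaussianReal (μ := stdGaussian E) (innerSL ℝ x)
  rw [variance_dual_stdGaussian, integral_strongDual_stdGaussian, innerSL_apply_norm, hx] at h
  simp only [one_pow, Real.toNNReal_one] at h
  rw [← h]
  congr 1
  funext v
  simp [real_inner_comm]

variable {μ : Measure E} [IsProbabilityMeasure μ]

/-- The odd moments of a balanced measure on the unit sphere vanish: averaging
`∫ x, sign ⟪v, x⟫ ∂μ = 0` over `v` Gaussian around `t • w` gives an odd power series in `t` with value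
zero, whose coefficients are nonzero multiples of these moments. -/
theorem integral_inner_odd_pow_eq_zero (hμ : ∀ᵐ x ∂μ, ‖x‖ = 1)
    (hb : ∀ v : E, μ.real {x | 0 < inner ℝ v x} = μ.real {x | inner ℝ v x < 0}) (w : E) (k : ℕ) :
    ∫ x, (inner ℝ w x : ℝ) ^ (2 * k + 1) ∂μ = 0 := by
  let Φ : ℝ → ℝ := fun s => ∫ g, Real.sign (g + s) ∂gaussianReal 0 1
  have hΦ : ∀ w : E, ∫ x, Φ (inner ℝ w x) ∂μ = 0 := by
    intro w
    have h1 : ∀ᵐ x ∂μ, Φ (inner ℝ w x) = ∫ v, Real.sign (inner ℝ (v + w) x) ∂stdGaussian E := by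
      filter_upwards [hμ] with x hx
      simp only [Φ]
      have hm : Measurable fun g : ℝ => Real.sign (g + inner ℝ w x) :=
        measurable_realSign.comp (measurable_id.add_const _)
      have hi : Measurable fun v : E => (inner ℝ v x : ℝ) := by fun_prop
      rw [← map_inner_stdGaussian x hx, integral_map hi.aemeasurable hm.aestronglyMeasurable]
      simp [inner_add_left]
    rw [integral_congr_ae h1, integral_integral_swap]
    · refine integral_eq_zero_of_ae (Eventually.of_forall fun v => ?_)
      have := integral_realSign_comp (μ := μ) (f := fun x => inner ℝ (v + w) x) (by fun_prop)
      simp [this, hb]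
    · exact integrable_realSign_comp (f := fun p : E × E => inner ℝ (p.2 + w) p.1) (by fun_prop)
  have h2 : ∀ t : ℝ, HasSum (fun k => (gaussSignCoeff k *
      ∫ x, (inner ℝ w x : ℝ) ^ (2 * k + 1) ∂μ) * t ^ (2 * k + 1)) 0 := by
    intro t
    have h3 := hasSum_integral_odd_powers (μ := μ) (y := fun x => inner ℝ (t • w) x) (by fun_prop)
      (R := ‖t • w‖) (by
        filter_upwards [hμ] with x hx
        simpa [hx] using abs_real_inner_le_norm (t • w) x)
      hasSum_integral_realSign_add_gaussianReal
    rw [show ∫ x, (∫ g, Real.sign (g + inner ℝ (t • w) x) ∂gaussianReal 0 1) ∂μ = 0 from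
      hΦ (t • w)] at h3
    refine h3.congr_fun fun k => ?_
    simp only [real_inner_smul_left, mul_pow, integral_const_mul]
    ring
  exact (mul_eq_zero.1 (eq_zero_of_hasSum_odd_powers h2 k)).resolve_left (gaussSignCoeff_ne_zero k)

/-- A probability measure on the unit sphere that gives opposite open half-spaces equal mass is
symmetric, because its characteristic function is real. -/
theorem map_neg_eq_self_of_balanced (hμ : ∀ᵐ x ∂μ, ‖x‖ = 1)
    (hb : ∀ v : E, μ.real {x | 0 < inner ℝ v x} = μ.real {x | inner ℝ v x < 0}) :
    μ.map (fun x => -x) = μ := by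
  have : IsProbabilityMeasure (μ.map fun x : E => -x) :=
    Measure.isProbabilityMeasure_map (by fun_prop)
  refine Measure.ext_of_charFun (funext fun t => ?_)
  have h1 : charFun (μ.map fun x : E => -x) t = charFun μ (-t) := by
    have := charFun_map_smul (μ := μ) (-1) t
    simpa using this
  have h2 : ∫ x, Real.sin (inner ℝ t x) ∂μ = 0 := by
    have h3 := hasSum_integral_odd_powers (μ := μ) (y := fun x => inner ℝ t x) (by fun_prop)
      (R := ‖t‖) (by
        filter_upwards [hμ] with x hx
        simpa [hx] using abs_real_inner_le_norm t x)
      (a := fun k => (-1) ^ k / ((2 * k + 1).factorial : ℝ)) (Φ := Real.sin)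
      (fun s => (Real.hasSum_sin s).congr_fun fun k => by ring)
    simp only [integral_inner_odd_pow_eq_zero hμ hb, mul_zero] at h3
    exact h3.unique hasSum_zero
  rw [h1, charFun_neg, Complex.conj_eq_iff_im, charFun_apply]
  have hint : Integrable (fun x => Complex.exp (inner ℝ x t * Complex.I)) μ :=
    Integrable.of_bound (Continuous.aestronglyMeasurable (by fun_prop)) 1
      (Eventually.of_forall fun x => (Complex.norm_exp_ofReal_mul_I _).le)
  have h4 := integral_im (𝕜 := ℂ) hint
  simp only [RCLike.im_to_complex, Complex.exp_ofReal_mul_I_im] at h4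
  rw [← h4, ← h2]
  simp only [real_inner_comm]

end symmetry

/-! ### Wendel's formula and separation of colour classes -/

section cones

variable {E : Type*} [NormedAddCommGroup E] [InnerProductSpace ℝ E]

theorem commonKer_insert {ι V : Type*} [DecidableEq ι] [AddCommGroup V] [Module ℝ V]
    (φ : ι → V →ₗ[ℝ] E) (W : Submodule ℝ V) (B : Finset ι) (j : ι) (x : ι → E) :
    commonKer φ W (insert j B) x = commonKer φ W B x ⊓ LinearMap.ker (pairing φ x j) := by
  rw [commonKer, commonKer, Finset.iInf_insert, inf_assoc, inf_comm (LinearMap.ker _)]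

theorem commonKer_empty {ι V : Type*} [AddCommGroup V] [Module ℝ V]
    (φ : ι → V →ₗ[ℝ] E) (W : Submodule ℝ V) (x : ι → E) : commonKer φ W ∅ x = W := by
  simp [commonKer]

/-- The hyperplanes orthogonal to vectors in general position intersect in the expected dimension. The
truncated subtraction makes it zero as soon as there are at least `finrank ℝ E` of them. -/
theorem genericFinrank_id {ι : Type*} [DecidableEq ι] [FiniteDimensional ℝ E] (B : Finset ι) :
    genericFinrank (fun _ : ι => (LinearMap.id : E →ₗ[ℝ] E)) ⊤ B =
      Module.finrank ℝ E - B.card := by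
  set φ := fun _ : ι => (LinearMap.id : E →ₗ[ℝ] E)
  have hle : ∀ x, Module.finrank ℝ E ≤ Module.finrank ℝ (commonKer φ ⊤ B x) + B.card := by
    intro x
    induction B using Finset.induction_on with
    | empty => rw [commonKer_empty, finrank_top]; simp
    | insert j B hj ih =>
      rw [commonKer_insert, Finset.card_insert_of_notMem hj]
      by_cases h : commonKer φ ⊤ B x ≤ LinearMap.ker (pairing φ x j)
      · rw [inf_eq_left.2 h]; omega
      · have := finrank_inf_ker_add_one _ _ h
        omega
  have hex : ∃ x, Module.finrank ℝ (commonKer φ ⊤ B x) = Module.finrank ℝ E - B.card := by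
    clear hle
    induction B using Finset.induction_on with
    | empty => exact ⟨0, by rw [commonKer_empty, finrank_top]; simp⟩
    | insert j B hj ih =>
      obtain ⟨x, hx⟩ := ih
      have hB : ∀ z, commonKer φ ⊤ B (Function.update x j z) = commonKer φ ⊤ B x := by
        intro z
        ext w
        simp only [mem_commonKer]
        refine and_congr_right fun _ => forall₂_congr fun b hb => ?_
        rw [Function.update_of_ne (ne_of_mem_of_not_mem hb hj)]
      rw [Finset.card_insert_of_notMem hj]
      by_cases h : commonKer φ ⊤ B x = ⊥
      · refine ⟨x, ?_⟩
        have h0 : Module.finrank ℝ (commonKer φ ⊤ B x) = 0 := by rw [h]; simp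
        rw [commonKer_insert, h]
        rw [bot_inf_eq, finrank_bot]
        omega
      · obtain ⟨u, hu, hu0⟩ := Submodule.exists_mem_ne_zero_of_ne_bot h
        refine ⟨Function.update x j u, ?_⟩
        rw [commonKer_insert, hB]
        have := finrank_inf_ker_add_one (commonKer φ ⊤ B x)
          (pairing φ (Function.update x j u) j) fun hle => hu0 (by
            have h1 := hle hu
            simpa [φ] using h1)
        omega
  obtain ⟨x, hx⟩ := hex
  refine le_antisymm ((Nat.sInf_le (Set.mem_range_self x)).trans_eq hx) ?_
  obtain ⟨y, hy⟩ : ∃ y : ι → E, Module.finrank ℝ (commonKer φ ⊤ B y) = genericFinrank φ ⊤ B :=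
    Nat.sInf_mem (Set.range_nonempty _)
  have := hle y
  omega

/-- By Pascal's rule each binomial coefficient of order `n - 1` occurs with the sum of two consecutive
signs, which is `2` below `d` and `0` from `d` on. -/
theorem sum_powerset_neg_one_pow_add_tsub (d : ℕ) {n : ℕ} (hn : 1 ≤ n) :
    ∑ B ∈ (Finset.univ : Finset (Fin n)).powerset, (-1 : ℝ) ^ (B.card + d + (d - B.card)) =
      2 * ∑ k ∈ Finset.range d, ((n - 1).choose k : ℝ) := by
  obtain ⟨M, rfl⟩ : ∃ M, n = M + 1 := ⟨n - 1, by omega⟩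
  have hs : ∀ k : ℕ, (-1 : ℝ) ^ (k + d + (d - k)) + (-1) ^ (k + 1 + d + (d - (k + 1))) =
      if k < d then 2 else 0 := by
    intro k
    split_ifs with h
    · rw [show k + d + (d - k) = 2 * d by omega, show k + 1 + d + (d - (k + 1)) = 2 * d by omega,
        pow_mul]
      norm_num
    · rw [show d - k = 0 by omega, show d - (k + 1) = 0 by omega]
      ring
  rw [Finset.sum_powerset_apply_card (fun k => (-1 : ℝ) ^ (k + d + (d - k))), Finset.card_univ,
    Fintype.card_fin, Finset.sum_range_succ']
  simp only [nsmul_eq_mul, Nat.choose_succ_succ, Nat.cast_add, add_mul, Finset.sum_add_distrib]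
  have h1 : ∑ k ∈ Finset.range (M + 1), (M.choose (k + 1) : ℝ) *
      (-1) ^ (k + 1 + d + (d - (k + 1))) + ((M + 1).choose 0 : ℝ) * (-1) ^ (0 + d + (d - 0)) =
      ∑ k ∈ Finset.range (M + 1), (M.choose k : ℝ) * (-1) ^ (k + d + (d - k)) := by
    rw [Finset.sum_range_succ, Finset.sum_range_succ' _ M]
    simp
  simp only [Nat.succ_eq_add_one] at h1 ⊢
  rw [add_assoc, h1, ← Finset.sum_add_distrib]
  simp only [← mul_add, add_comm ((-1 : ℝ) ^ (_ + 1 + d + _)), hs, mul_ite, mul_zero]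
  rw [← Finset.sum_filter, Finset.mul_sum]
  simp only [add_tsub_cancel_right, mul_comm (2 : ℝ)]
  refine Finset.sum_subset (fun k => by simp) fun k hk hk' => ?_
  simp only [Finset.mem_range, Finset.mem_filter, not_and_or, not_lt] at hk hk'
  rw [Nat.choose_eq_zero_of_lt (by omega)]
  simp

/-- The formula of Wendel, in the generality of Wagner and Welzl, for the probability that `n` random
points lie in an open half-space bounded by a hyperplane through the origin. -/
theorem measureReal_exists_forall_inner_pos [FiniteDimensional ℝ E] [MeasurableSpace E]
    [BorelSpace E] {n : ℕ} (hn : 1 ≤ n) {μ : Measure E}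
    [IsProbabilityMeasure μ] (hμ : ∀ v : E, v ≠ 0 → ∀ᵐ z ∂μ, inner ℝ z v ≠ 0)
    (hs : μ.map (fun z => -z) = μ) :
    (Measure.pi fun _ : Fin n => μ).real {x | ∃ w : E, ∀ j, 0 < inner ℝ (x j) w} =
      1 / 2 ^ (n - 1) * ∑ k ∈ Finset.range (Module.finrank ℝ E), ((n - 1).choose k : ℝ) := by
  have h := measureReal_posSolvable (fun _ : Fin n => (LinearMap.id : E →ₗ[ℝ] E)) ⊤ Finset.univ hμ hs
  simp only [genericFinrank_id, finrank_top, sum_powerset_neg_one_pow_add_tsub _ hn] at h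
  have hset : posSolvable (fun _ : Fin n => (LinearMap.id : E →ₗ[ℝ] E)) ⊤ Finset.univ =
      {x | ∃ w : E, ∀ j, 0 < inner ℝ (x j) w} := by
    ext x; simp [posSolvable]
  rw [hset] at h
  rw [h, Finset.card_univ, Fintype.card_fin]
  obtain ⟨M, rfl⟩ : ∃ M, n = M + 1 := ⟨n - 1, by omega⟩
  rw [add_tsub_cancel_right, pow_succ]
  simp
  ring

variable {m n : ℕ}

/-- Colour class `c` lies in an open half-space bounded by a hyperplane through the origin. -/
def InOpenHalfSpace (x : Fin m × Fin n → E) (c : Fin m) : Prop :=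
  ∃ u : E, ∀ j, 0 < inner ℝ (x (c, j)) u

/-- The colour classes in `S` lie in open half-spaces through the origin whose normal vectors sum
to zero. If `S` is nonempty, these half-spaces have no common point. -/
def SeparatedOn (x : Fin m × Fin n → E) (S : Finset (Fin m)) : Prop :=
  ∃ w : Fin m → E, ∑ c ∈ S, w c = 0 ∧ ∀ c ∈ S, ∀ j, 0 < inner ℝ (x (c, j)) (w c)

theorem SeparatedOn.inOpenHalfSpace {x : Fin m × Fin n → E} {S : Finset (Fin m)}
    (h : SeparatedOn x S) {c : Fin m} (hc : c ∈ S) : InOpenHalfSpace x c := by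
  obtain ⟨w, -, hw⟩ := h
  exact ⟨w c, hw c hc⟩

/-- A further class in an open half-space can be given a small normal vector, compensated by a small
change of one of the old normals. -/
theorem SeparatedOn.insert {x : Fin m × Fin n → E} {S : Finset (Fin m)} (hS : S.Nonempty)
    (h : SeparatedOn x S) {c : Fin m} (hcS : c ∉ S) (hc : InOpenHalfSpace x c) :
    SeparatedOn x (insert c S) := by
  obtain ⟨w, hw0, hw⟩ := h
  obtain ⟨u, hu⟩ := hc
  obtain ⟨a, ha⟩ := hS
  obtain ⟨t, ht, ht'⟩ := exists_pos_add_smul (fun j => innerₗ E (x (a, j))) Finset.univ (w a) (-u)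
    fun j _ => hw a ha j
  have hca : c ≠ a := fun h => hcS (h ▸ ha)
  refine ⟨Function.update (Function.update w a (w a + t • (-u))) c (t • u), ?_, ?_⟩
  · rw [Finset.sum_insert hcS, Function.update_self, Finset.sum_update_of_notMem hcS,
      Finset.sum_update_of_mem ha]
    rw [← Finset.add_sum_erase S w ha, Finset.erase_eq] at hw0
    calc t • u + (w a + t • -u + ∑ i ∈ S \ {a}, w i) = w a + ∑ i ∈ S \ {a}, w i := by
          rw [smul_neg]; abel
      _ = 0 := hw0
  · intro b hb j
    rcases Finset.mem_insert.1 hb with rfl | hb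
    · rw [Function.update_self, inner_smul_right]
      exact mul_pos ht (hu j)
    · rw [Function.update_of_ne (ne_of_mem_of_not_mem hb hcS)]
      rcases eq_or_ne b a with rfl | hba
      · rw [Function.update_self]
        exact ht' j (Finset.mem_univ j)
      · rw [Function.update_of_ne hba]
        exact hw b hb j

theorem SeparatedOn.union {x : Fin m × Fin n → E} {S : Finset (Fin m)} (hS : S.Nonempty)
    (h : SeparatedOn x S) (T : Finset (Fin m)) (hT : ∀ c ∈ T, InOpenHalfSpace x c) :
    SeparatedOn x (T ∪ S) := by
  induction T using Finset.induction_on with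
  | empty => simpa using h
  | insert c T hc ih =>
    rw [Finset.insert_union]
    have ih' := ih fun b hb => hT b (Finset.mem_insert_of_mem hb)
    by_cases hcT : c ∈ T ∪ S
    · rwa [Finset.insert_eq_of_mem hcT]
    · exact ih'.insert (hS.mono Finset.subset_union_right) hcT (hT c (Finset.mem_insert_self _ _))

open Classical in
/-- If some nonempty set of classes is separated, then so is the set `P` of all classes that lie in an
open half-space, and the inclusion-exclusion sum over `T` singles out `S = P`. Every event on
the right is a system of strict linear inequalities. -/
theorem ite_exists_separatedOn (x : Fin m × Fin n → E) :
    (if ∃ S : Finset (Fin m), S.Nonempty ∧ SeparatedOn x S then 1 else 0 : ℝ) =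
      ∑ S : Finset (Fin m) with S.Nonempty, ∑ T ∈ Sᶜ.powerset, (-1) ^ T.card *
        (if SeparatedOn x S ∧ ∀ c ∈ T, InOpenHalfSpace x c then 1 else 0) := by
  let P : Finset (Fin m) := Finset.univ.filter (InOpenHalfSpace x)
  have hin : ∀ S : Finset (Fin m), ∑ T ∈ Sᶜ.powerset, (-1 : ℝ) ^ T.card *
      (if SeparatedOn x S ∧ ∀ c ∈ T, InOpenHalfSpace x c then 1 else 0) =
      if SeparatedOn x S ∧ S = P then 1 else 0 := by
    intro S
    by_cases hS : SeparatedOn x S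
    · have hSP : S ⊆ P := fun c hc => by simpa [P] using hS.inOpenHalfSpace hc
      have h1 : ∀ T : Finset (Fin m), (∀ c ∈ T, InOpenHalfSpace x c) ↔ T ⊆ P := fun T => by
        simp [P, Finset.subset_iff]
      simp only [hS, true_and, h1, mul_ite, mul_one, mul_zero]
      rw [← Finset.sum_filter]
      have h2 : Sᶜ.powerset.filter (· ⊆ P) = (Sᶜ ∩ P).powerset := by
        ext T; simp only [Finset.mem_filter, Finset.mem_powerset, Finset.subset_inter_iff]
      have h3 := congrArg (Int.cast : ℤ → ℝ) (Finset.sum_powerset_neg_one_pow_card (x := Sᶜ ∩ P))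
      push_cast at h3
      rw [h2, h3]
      refine if_congr ?_ rfl rfl
      rw [← Finset.disjoint_iff_inter_eq_empty, disjoint_compl_left_iff]
      exact ⟨fun h => hSP.antisymm h, fun h => h.ge⟩
    · simp [hS]
  rw [Finset.sum_congr rfl fun S _ => hin S]
  have h4 : (∃ S : Finset (Fin m), S.Nonempty ∧ SeparatedOn x S) ↔ P.Nonempty ∧ SeparatedOn x P := by
    constructor
    · rintro ⟨S, hS, h⟩
      have hSP : S ⊆ P := fun c hc => by simpa [P] using h.inOpenHalfSpace hc
      have := h.union hS P fun c hc => by simpa [P] using hc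
      rw [Finset.union_eq_left.2 hSP] at this
      exact ⟨hS.mono hSP, this⟩
    · exact fun h => ⟨P, h⟩
  rw [if_congr h4 rfl rfl, Finset.sum_filter]
  rw [Finset.sum_eq_single P]
  · simp [ite_and]
  · intro S _ hSP
    simp [hSP]
  · simp

/-- The families of vectors indexed by the colours whose sum over `S` vanishes. -/
def sumZero (E : Type*) [NormedAddCommGroup E] [InnerProductSpace ℝ E] (S : Finset (Fin m)) :
    Submodule ℝ (Fin m → E) :=
  LinearMap.ker (∑ c ∈ S, (LinearMap.proj c : (Fin m → E) →ₗ[ℝ] E))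

/-- Solvability over `sumZero E S` with constraints from the classes in `S ∪ T`: the normals of the
classes in `T` are unconstrained by the sum condition. -/
theorem mem_posSolvable_sumZero (S T : Finset (Fin m))
    (x : Fin m × Fin n → E) :
    x ∈ posSolvable (fun i : Fin m × Fin n => (LinearMap.proj i.1 : (Fin m → E) →ₗ[ℝ] E))
      (sumZero E S) ((S ∪ T) ×ˢ Finset.univ) ↔
      SeparatedOn x S ∧ ∀ c ∈ T, InOpenHalfSpace x c := by
  simp only [posSolvable, sumZero, Set.mem_ofPred_eq, LinearMap.mem_ker, LinearMap.sum_apply,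
    LinearMap.proj_apply, Prod.forall, Finset.mem_product, Finset.mem_union, Finset.mem_univ,
    and_true]
  constructor
  · rintro ⟨w, hw0, hw⟩
    exact ⟨⟨w, hw0, fun c hc j => hw c j (Or.inl hc)⟩, fun c hc => ⟨w c, fun j => hw c j (Or.inr hc)⟩⟩
  · classical
    rintro ⟨⟨w, hw0, hw⟩, hT⟩
    choose! u hu using hT
    refine ⟨fun c => if c ∈ S then w c else u c, ?_, ?_⟩
    · rw [← hw0]
      exact Finset.sum_congr rfl fun c hc => if_pos hc
    · intro c j hc
      by_cases hcS : c ∈ S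
      · simpa [hcS] using hw c hcS j
      · simpa [hcS] using hu c (hc.resolve_left hcS) j

theorem isOpen_setOf_exists_separatedOn :
    IsOpen {x : Fin m × Fin n → E | ∃ S : Finset (Fin m), S.Nonempty ∧ SeparatedOn x S} := by
  have : {x : Fin m × Fin n → E | ∃ S : Finset (Fin m), S.Nonempty ∧ SeparatedOn x S} =
      ⋃ S : Finset (Fin m), ⋃ _ : S.Nonempty,
        posSolvable (fun i : Fin m × Fin n => (LinearMap.proj i.1 : (Fin m → E) →ₗ[ℝ] E))
          (sumZero E S) ((S ∪ ∅) ×ˢ Finset.univ) := by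
    ext x
    simp only [Set.mem_iUnion, mem_posSolvable_sumZero]
    simp
  rw [this]
  exact isOpen_iUnion fun S => isOpen_iUnion fun _ => isOpen_posSolvable _ _ _

variable [FiniteDimensional ℝ E] [MeasurableSpace E] [BorelSpace E]

theorem measureReal_exists_separatedOn (μ : Measure (Fin m × Fin n → E)) [IsFiniteMeasure μ] :
    μ.real {x | ∃ S : Finset (Fin m), S.Nonempty ∧ SeparatedOn x S} =
      ∑ S : Finset (Fin m) with S.Nonempty, ∑ T ∈ Sᶜ.powerset, (-1) ^ T.card *
        μ.real (posSolvable
          (fun i : Fin m × Fin n => (LinearMap.proj i.1 : (Fin m → E) →ₗ[ℝ] E))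
          (sumZero E S) ((S ∪ T) ×ˢ Finset.univ)) := by
  classical
  have hm : ∀ S T : Finset (Fin m), MeasurableSet (posSolvable
      (fun i : Fin m × Fin n => (LinearMap.proj i.1 : (Fin m → E) →ₗ[ℝ] E))
      (sumZero E S) ((S ∪ T) ×ˢ Finset.univ)) := fun S T =>
    (isOpen_posSolvable _ _ _).measurableSet
  simp only [← integral_indicator_one isOpen_setOf_exists_separatedOn.measurableSet,
    ← integral_indicator_one (hm _ _), ← integral_const_mul]
  have hi : ∀ S T : Finset (Fin m), Integrable (fun x => (-1 : ℝ) ^ T.card * (posSolvable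
      (fun i : Fin m × Fin n => (LinearMap.proj i.1 : (Fin m → E) →ₗ[ℝ] E))
      (sumZero E S) ((S ∪ T) ×ˢ Finset.univ)).indicator 1 x) μ := fun S T =>
    ((integrable_const (1 : ℝ)).indicator (hm S T)).const_mul _
  rw [Finset.sum_congr rfl fun S _ => (integral_finsetSum _ fun T _ => hi S T).symm,
    ← integral_finsetSum _ fun S _ => integrable_finsetSum _ fun T _ => hi S T]
  congr 1
  funext x
  have := ite_exists_separatedOn x
  rw [Set.indicator_apply]
  simp only [Set.mem_ofPred_eq, Pi.one_apply]
  rw [this]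
  refine Finset.sum_congr rfl fun S _ => Finset.sum_congr rfl fun T _ => ?_
  rw [Set.indicator_apply, if_congr (mem_posSolvable_sumZero S T x) rfl rfl]
  rfl

/-- The probability that some nonempty set of classes is separated is the same for all symmetric laws
that do not charge hyperplanes through the origin. -/
theorem measureReal_exists_separatedOn_congr {μ ν : Measure E} [IsProbabilityMeasure μ]
    [IsProbabilityMeasure ν] (hμ : ∀ v : E, v ≠ 0 → ∀ᵐ z ∂μ, inner ℝ z v ≠ 0)
    (hμs : μ.map (fun z => -z) = μ) (hν : ∀ v : E, v ≠ 0 → ∀ᵐ z ∂ν, inner ℝ z v ≠ 0)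
    (hνs : ν.map (fun z => -z) = ν) :
    (Measure.pi fun _ : Fin m × Fin n => μ).real
        {x | ∃ S : Finset (Fin m), S.Nonempty ∧ SeparatedOn x S} =
      (Measure.pi fun _ : Fin m × Fin n => ν).real
        {x | ∃ S : Finset (Fin m), S.Nonempty ∧ SeparatedOn x S} := by
  simp only [measureReal_exists_separatedOn, measureReal_posSolvable _ _ _ hμ hμs,
    measureReal_posSolvable _ _ _ hν hνs]

end cones

/-! ### The Gaussian law -/

section gaussian

open ProbabilityTheory Filter

theorem measurableSet_forall_curry_mem {α κ X : Type*} [Countable α] [MeasurableSpace X]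
    {A : Set (κ → X)} (hA : MeasurableSet A) :
    MeasurableSet {x : α × κ → X | ∀ a, (fun k => x (a, k)) ∈ A} := by
  have : {x : α × κ → X | ∀ a, (fun k => x (a, k)) ∈ A} =
      ⋂ a, (fun (x : α × κ → X) k => x (a, k)) ⁻¹' A := by
    ext x; simp
  rw [this]
  exact MeasurableSet.iInter fun a =>
    (measurable_pi_lambda _ fun k => measurable_pi_apply (a, k)) hA

theorem measureReal_pi_forall_curry_mem {α κ X : Type*} [Fintype α] [Fintype κ] [MeasurableSpace X]
    (ν : Measure X) [IsProbabilityMeasure ν] (A : Set (κ → X)) :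
    (Measure.pi fun _ : α × κ => ν).real {x | ∀ a, (fun k => x (a, k)) ∈ A} =
      (Measure.pi fun _ : κ => ν).real A ^ Fintype.card α := by
  have h := Measure.infinitePi_map_curry (fun (_ : α) (_ : κ) => ν)
  simp only [Measure.infinitePi_eq_pi] at h
  have hset : {x : α × κ → X | ∀ a, (fun k => x (a, k)) ∈ A} =
      MeasurableEquiv.curry α κ X ⁻¹' (Set.univ.pi fun _ => A) := by
    ext x
    simp only [Set.mem_ofPred_eq, Set.mem_preimage, Set.mem_pi, Set.mem_univ, forall_const]
    rfl
  rw [hset, measureReal_def, ← MeasurableEquiv.map_apply, h, Measure.pi_pi]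
  simp [measureReal_def]

theorem gaussianReal_real_Iio_zero : (gaussianReal 0 1).real (Set.Iio 0) = 1 / 2 ∧
    (gaussianReal 0 1).real (Set.Ioi 0) = 1 / 2 := by
  have h1 := integral_realSign_add_gaussianReal 0
  simp only [add_zero, neg_zero, intervalIntegral.integral_same, mul_zero] at h1
  rw [integral_realSign_comp (f := fun x => x) measurable_id] at h1
  have h2 : (gaussianReal 0 1).real (Set.Iio 0 ∪ Set.Ioi 0) = 1 := by
    have := nullSingletonClass_gaussianReal (μ := 0) (v := 1) one_ne_zero
    rw [Set.Iio_union_Ioi, probReal_compl_eq_one_sub (measurableSet_singleton _),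
      measureReal_def, measure_singleton]
    simp
  have h3 : Disjoint (Set.Iio (0 : ℝ)) (Set.Ioi 0) :=
    Set.disjoint_left.2 fun x hx hx' => lt_asymm (Set.mem_Iio.1 hx) (Set.mem_Ioi.1 hx')
  rw [measureReal_union h3 measurableSet_Ioi] at h2
  change (gaussianReal 0 1).real (Set.Ioi 0) - (gaussianReal 0 1).real (Set.Iio 0) = 0 at h1
  constructor <;> linarith

/-- In dimension one: the probability that no class is strictly negative or no class is strictly
positive. -/
theorem measureReal_pi_gaussianReal_forall_exists (m : ℕ) {n : ℕ} (hn : 1 ≤ n) :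
    (Measure.pi fun _ : Fin m × Fin n => gaussianReal 0 1).real
      {y | (∀ c, ∃ j, 0 ≤ y (c, j)) ∨ (∀ c, ∃ j, y (c, j) ≤ 0)} =
      2 * (1 - 1 / 2 ^ n) ^ m - (1 - 1 / 2 ^ (n - 1)) ^ m := by
  set N := Measure.pi fun _ : Fin n => gaussianReal 0 1
  let A : Set (Fin n → ℝ) := Set.univ.pi fun _ => Set.Iio 0
  let B : Set (Fin n → ℝ) := Set.univ.pi fun _ => Set.Ioi 0
  have hA : MeasurableSet A := MeasurableSet.univ_pi fun _ => measurableSet_Iio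
  have hB : MeasurableSet B := MeasurableSet.univ_pi fun _ => measurableSet_Ioi
  have hNA : N.real A = 1 / 2 ^ n := by
    have h := gaussianReal_real_Iio_zero.1
    rw [measureReal_def] at h
    simp only [A, N, measureReal_def, Measure.pi_pi, ENNReal.toReal_prod, h]
    simp
  have hNB : N.real B = 1 / 2 ^ n := by
    have h := gaussianReal_real_Iio_zero.2
    rw [measureReal_def] at h
    simp only [B, N, measureReal_def, Measure.pi_pi, ENNReal.toReal_prod, h]
    simp
  have hAB : Disjoint A B := by
    refine Set.disjoint_left.2 fun y hy hy' => ?_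
    have h1 := hy ⟨0, hn⟩ (Set.mem_univ _)
    have h2 := hy' ⟨0, hn⟩ (Set.mem_univ _)
    exact lt_asymm (Set.mem_Iio.1 h1) (Set.mem_Ioi.1 h2)
  have hNAB : N.real (A ∪ B) = 1 / 2 ^ (n - 1) := by
    rw [measureReal_union hAB hB, hNA, hNB]
    obtain ⟨M, rfl⟩ : ∃ M, n = M + 1 := ⟨n - 1, by omega⟩
    rw [add_tsub_cancel_right, pow_succ]
    field_simp
    norm_num
  have hmA : ∀ y : Fin n → ℝ, y ∈ Aᶜ ↔ ∃ j, 0 ≤ y j := fun y => by simp [A]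
  have hmB : ∀ y : Fin n → ℝ, y ∈ Bᶜ ↔ ∃ j, y j ≤ 0 := fun y => by simp [B]
  have key : ∀ C : Set (Fin n → ℝ), MeasurableSet C →
      (Measure.pi fun _ : Fin m × Fin n => gaussianReal 0 1).real
        {y | ∀ c, (fun j => y (c, j)) ∈ Cᶜ} = (1 - N.real C) ^ m := by
    intro C hC
    rw [measureReal_pi_forall_curry_mem, probReal_compl_eq_one_sub hC, Fintype.card_fin]
  have hmeas : ∀ C : Set (Fin n → ℝ), MeasurableSet C →
      MeasurableSet {y : Fin m × Fin n → ℝ | ∀ c, (fun j => y (c, j)) ∈ Cᶜ} :=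
    fun C hC => measurableSet_forall_curry_mem hC.compl
  have hu := measureReal_union_add_inter
    (μ := Measure.pi fun _ : Fin m × Fin n => gaussianReal 0 1)
    (s := {y | ∀ c, (fun j => y (c, j)) ∈ Aᶜ}) (hmeas B hB)
  have hi : {y : Fin m × Fin n → ℝ | ∀ c, (fun j => y (c, j)) ∈ Aᶜ} ∩
      {y | ∀ c, (fun j => y (c, j)) ∈ Bᶜ} = {y | ∀ c, (fun j => y (c, j)) ∈ (A ∪ B)ᶜ} := by
    ext y
    simp only [Set.mem_inter_iff, Set.mem_ofPred_eq, ← forall_and, Set.compl_union]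
  rw [hi, key A hA, key B hB, key _ (hA.union hB), hNA, hNB, hNAB] at hu
  have hs : {y : Fin m × Fin n → ℝ | (∀ c, ∃ j, 0 ≤ y (c, j)) ∨ (∀ c, ∃ j, y (c, j) ≤ 0)} =
      {y | ∀ c, (fun j => y (c, j)) ∈ Aᶜ} ∪ {y | ∀ c, (fun j => y (c, j)) ∈ Bᶜ} := by
    ext y
    simp only [Set.mem_union, Set.mem_ofPred_eq, hmA, hmB]
  rw [hs]
  linarith

/-- Independent standard Gaussian vectors, assembled from independent Gaussian coordinates. The
coordinate index `k` comes first, so that events depending on one coordinate each are independent by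
`measureReal_pi_forall_curry_mem`. -/
theorem measurePreserving_pi_stdGaussian (d : ℕ) (ι : Type*) [Fintype ι] :
    MeasurePreserving (fun (z : Fin d × ι → ℝ) (i : ι) =>
        (WithLp.toLp 2 fun k => z (k, i) : EuclideanSpace ℝ (Fin d)))
      (Measure.pi fun _ => gaussianReal 0 1)
      (Measure.pi fun _ => stdGaussian (EuclideanSpace ℝ (Fin d))) := by
  have h1 := measurePreserving_piCongrLeft (α := fun _ : ι × Fin d => ℝ)
    (fun _ => gaussianReal 0 1) (Equiv.prodComm (Fin d) ι)
  have h2 := Measure.infinitePi_map_curry (fun (_ : ι) (_ : Fin d) => gaussianReal 0 1)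
  simp only [Measure.infinitePi_eq_pi] at h2
  have h3 : MeasurePreserving (MeasurableEquiv.curry ι (Fin d) ℝ)
      (Measure.pi fun _ => gaussianReal 0 1) (Measure.pi fun _ => Measure.pi fun _ => gaussianReal 0 1) :=
    ⟨MeasurableEquiv.measurable _, h2⟩
  have h4 : MeasurePreserving (fun (y : ι → Fin d → ℝ) i =>
      (WithLp.toLp 2 (y i) : EuclideanSpace ℝ (Fin d)))
      (Measure.pi fun _ => Measure.pi fun _ => gaussianReal 0 1)
      (Measure.pi fun _ => stdGaussian (EuclideanSpace ℝ (Fin d))) :=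
    measurePreserving_pi _ _ fun _ => ⟨by fun_prop, map_pi_eq_stdGaussian⟩
  have h5 := h4.comp (h3.comp h1)
  convert h5 using 1
  funext z i
  ext k
  exact (MeasurableEquiv.piCongrLeft_apply_apply (β := fun _ : ι × Fin d => ℝ)
    (Equiv.prodComm (Fin d) ι) z (k, i)).symm

variable {E : Type*} [NormedAddCommGroup E] [InnerProductSpace ℝ E] [FiniteDimensional ℝ E]
  [MeasurableSpace E] [BorelSpace E]

theorem ae_stdGaussian_inner_ne_zero (v : E) (hv : v ≠ 0) :
    ∀ᵐ z ∂stdGaussian E, inner ℝ z v ≠ 0 := by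
  have h1 := map_inner_stdGaussian ((‖v‖)⁻¹ • v) (norm_smul_inv_norm (𝕜 := ℝ) hv)
  have h2 : ∀ᵐ g ∂gaussianReal 0 1, g ≠ 0 := by
    have := nullSingletonClass_gaussianReal (μ := 0) (v := 1) one_ne_zero
    simp [ae_iff]
  rw [← h1] at h2
  have h3 := ae_of_ae_map (by fun_prop) h2
  filter_upwards [h3] with z hz hz'
  exact hz (by rw [inner_smul_right, hz', mul_zero])

theorem map_neg_stdGaussian : (stdGaussian E).map (fun z => -z) = stdGaussian E :=
  stdGaussian_map (LinearIsometryEquiv.neg ℝ)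

/-- Without separation, no coordinate has both a strictly negative and a strictly positive class. -/
theorem measureReal_stdGaussian_compl_exists_separatedOn_le (d m : ℕ) {n : ℕ} (hn : 1 ≤ n) :
    (Measure.pi fun _ : Fin m × Fin n => stdGaussian (EuclideanSpace ℝ (Fin d))).real
      {x | ∃ S : Finset (Fin m), S.Nonempty ∧ SeparatedOn x S}ᶜ ≤
      (2 * (1 - 1 / 2 ^ n) ^ m - (1 - 1 / 2 ^ (n - 1)) ^ m) ^ d := by
  have hG := measurePreserving_pi_stdGaussian d (Fin m × Fin n)
  let Q : Set (Fin m × Fin n → ℝ) :=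
    {y | (∀ c, ∃ j, 0 ≤ y (c, j)) ∨ (∀ c, ∃ j, y (c, j) ≤ 0)}
  have hQ : MeasurableSet Q := by
    have h1 : Q = (⋂ c, ⋃ j, {y | 0 ≤ y (c, j)}) ∪ ⋂ c, ⋃ j, {y | y (c, j) ≤ 0} := by
      ext y; simp [Q]
    rw [h1]
    exact (MeasurableSet.iInter fun c => MeasurableSet.iUnion fun j =>
      measurableSet_le measurable_const (measurable_pi_apply _)).union
      (MeasurableSet.iInter fun c => MeasurableSet.iUnion fun j =>
      measurableSet_le (measurable_pi_apply _) measurable_const)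
  rw [← hG.measureReal_preimage isOpen_setOf_exists_separatedOn.measurableSet.compl.nullMeasurableSet,
    ← measureReal_pi_gaussianReal_forall_exists m hn]
  have h2 := measureReal_pi_forall_curry_mem (α := Fin d) (gaussianReal 0 1) Q
  rw [Fintype.card_fin] at h2
  rw [← h2]
  refine measureReal_mono ?_
  intro z hz k
  by_contra hk
  simp only [Q, Set.mem_ofPred_eq, not_or, not_forall, not_exists, not_le] at hk
  obtain ⟨⟨a, ha⟩, b, hb⟩ := hk
  refine hz ⟨{a, b}, ⟨a, by simp⟩, ?_⟩
  have hab : a ≠ b := by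
    rintro rfl
    exact lt_asymm (ha ⟨0, hn⟩) (hb ⟨0, hn⟩)
  refine ⟨fun c => if c = a then -EuclideanSpace.single k 1 else EuclideanSpace.single k 1, ?_, ?_⟩
  · rw [Finset.sum_pair hab]
    simp [hab.symm]
  · intro c hc j
    rcases Finset.mem_insert.1 hc with rfl | hc
    · simpa [EuclideanSpace.inner_single_right] using ha j
    · rw [Finset.mem_singleton.1 hc]
      simpa [EuclideanSpace.inner_single_right, hab.symm] using hb j

end gaussian

/-! ### Radial projection and the two bounds -/

section radial

variable {E : Type*} [NormedAddCommGroup E] [InnerProductSpace ℝ E]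

/-- The radial projection of `E` from the point `p` onto the unit sphere around the origin. The
point `p` itself is sent to `0`. -/
noncomputable def radialProj (p x : E) : E := ‖x - p‖⁻¹ • (x - p)

theorem inner_radialProj_pos_iff {p x w : E} :
    0 < (inner ℝ w (radialProj p x) : ℝ) ↔ 0 < (inner ℝ w (x - p) : ℝ) := by
  rcases eq_or_ne (x - p) 0 with h | h
  · simp [radialProj, h]
  · rw [radialProj, inner_smul_right]
    exact mul_pos_iff_of_pos_left (by positivity)

theorem inner_radialProj_neg_iff {p x w : E} :
    (inner ℝ w (radialProj p x) : ℝ) < 0 ↔ (inner ℝ w (x - p) : ℝ) < 0 := by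
  have := inner_radialProj_pos_iff (p := p) (x := x) (w := -w)
  simpa using this

theorem mem_convexHull_of_not_exists_inner_pos [CompleteSpace E] {n : ℕ} {p : E} {y : Fin n → E}
    (h : ¬ ∃ w : E, ∀ j, 0 < (inner ℝ (radialProj p (y j)) w : ℝ)) :
    p ∈ convexHull ℝ (Set.range y) := by
  by_contra hp
  obtain ⟨f, u, hu, hf⟩ := geometric_hahn_banach_point_closed (convex_convexHull ℝ (Set.range y))
    ((Set.finite_range y).isClosed_convexHull ℝ) hp
  refine h ⟨(InnerProductSpace.toDual ℝ E).symm f, fun j => ?_⟩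
  have h1 := hf (y j) (subset_convexHull ℝ _ (Set.mem_range_self j))
  rw [real_inner_comm, inner_radialProj_pos_iff, InnerProductSpace.toDual_symm_apply, map_sub]
  linarith

/-- At a common point `t` of the hulls all the numbers `⟪w c, t - p⟫` would be positive, while they
sum to zero. -/
theorem not_nonempty_iInter_convexHull_of_separatedOn {m n : ℕ} {p : E} {x : Fin m × Fin n → E}
    {S : Finset (Fin m)} (hS : S.Nonempty) (h : SeparatedOn (fun i => radialProj p (x i)) S) :
    ¬ (⋂ i : Fin m, convexHull ℝ (Set.range fun j : Fin n => x (i, j))).Nonempty := by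
  rintro ⟨t, ht⟩
  obtain ⟨w, hw0, hw⟩ := h
  have hpos : ∀ c ∈ S, 0 < (inner ℝ (w c) (t - p) : ℝ) := by
    intro c hc
    have hconv : Convex ℝ {z : E | 0 < (inner ℝ (w c) (z - p) : ℝ)} := by
      simp only [inner_sub_right, sub_pos]
      exact convex_halfSpace_gt (innerₗ E (w c)).isLinear _
    have hsub : (Set.range fun j : Fin n => x (c, j)) ⊆
        {z : E | 0 < (inner ℝ (w c) (z - p) : ℝ)} := by
      rintro _ ⟨j, rfl⟩
      have := hw c hc j
      rw [real_inner_comm] at this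
      exact inner_radialProj_pos_iff.1 this
    exact convexHull_min hsub hconv (Set.mem_iInter.1 ht c)
  have := Finset.sum_pos hpos hS
  rw [← sum_inner, hw0, inner_zero_left] at this
  exact lt_irrefl _ this

variable [MeasurableSpace E] [BorelSpace E]

theorem measurable_radialProj [SecondCountableTopology E] (p : E) : Measurable (radialProj p) := by
  unfold radialProj
  fun_prop

/-- The radial projection of a balanced law does not charge hyperplanes through the origin and is
symmetric. -/
theorem BalancedAbout.map_radialProj {d : ℕ} {D : Measure (EuclideanSpace ℝ (Fin d))}
    [IsProbabilityMeasure D] {p : EuclideanSpace ℝ (Fin d)} (hD : BalancedAbout D p) :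
    (∀ v, v ≠ 0 → ∀ᵐ z ∂D.map (radialProj p), inner ℝ z v ≠ 0) ∧
      (D.map (radialProj p)).map (fun z => -z) = D.map (radialProj p) := by
  set μ := D.map (radialProj p) with hμ
  have hm := measurable_radialProj p
  have : IsProbabilityMeasure μ := Measure.isProbabilityMeasure_map hm.aemeasurable
  have hpos : ∀ v, v ≠ 0 → μ {z | 0 < inner ℝ v z} = 1 / 2 := by
    intro v hv
    rw [hμ, Measure.map_apply hm (measurableSet_lt measurable_const (by fun_prop)), ← (hD v hv).1]
    congr 1
    ext x
    exact inner_radialProj_pos_iff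
  have hneg : ∀ v, v ≠ 0 → μ {z | inner ℝ v z < 0} = 1 / 2 := by
    intro v hv
    rw [hμ, Measure.map_apply hm (measurableSet_lt (by fun_prop) measurable_const), ← (hD v hv).2]
    congr 1
    ext x
    exact inner_radialProj_neg_iff
  have hne : ∀ v, v ≠ 0 → ∀ᵐ z ∂μ, inner ℝ z v ≠ 0 := by
    intro v hv
    have h1 : MeasurableSet {z : EuclideanSpace ℝ (Fin d) | inner ℝ v z < 0} :=
      measurableSet_lt (by fun_prop) measurable_const
    have h2 : MeasurableSet {z : EuclideanSpace ℝ (Fin d) | 0 < inner ℝ v z} :=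
      measurableSet_lt measurable_const (by fun_prop)
    have h3 : μ ({z | 0 < inner ℝ v z} ∪ {z | inner ℝ v z < 0}) = 1 := by
      have hdisj : Disjoint {z : EuclideanSpace ℝ (Fin d) | 0 < inner ℝ v z}
          {z | inner ℝ v z < 0} :=
        Set.disjoint_left.2 fun z hz hz' => lt_asymm (Set.mem_ofPred_eq ▸ hz) hz'
      rw [measure_union hdisj h1, hpos v hv,
        hneg v hv, ENNReal.add_halves]
    have h4 := (prob_compl_eq_zero_iff (h2.union h1)).2 h3
    filter_upwards [compl_mem_ae_iff.2 h4] with z hz h0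
    rw [real_inner_comm] at h0
    simp [h0] at hz
  refine ⟨hne, ?_⟩
  rcases subsingleton_or_nontrivial (EuclideanSpace ℝ (Fin d)) with hs | hs
  -- In dimension zero the projected law is carried by `0` and not by the unit sphere.
  · rw [show (fun z : EuclideanSpace ℝ (Fin d) => -z) = id from
      funext fun z => Subsingleton.elim _ _, Measure.map_id]
  refine map_neg_eq_self_of_balanced ?_ fun v => ?_
  · obtain ⟨v, hv⟩ := exists_ne (0 : EuclideanSpace ℝ (Fin d))
    rw [hμ, ae_map_iff hm.aemeasurable (measurableSet_eq_fun (by fun_prop) (by fun_prop))]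
    filter_upwards [ae_of_ae_map hm.aemeasurable (hne v hv)] with x hx
    have hx0 : x - p ≠ 0 := by
      intro h0
      simp [radialProj, h0] at hx
    exact norm_smul_inv_norm (𝕜 := ℝ) hx0
  · rcases eq_or_ne v 0 with rfl | hv
    · simp
    · rw [measureReal_def, measureReal_def, hpos v hv, hneg v hv]

end radial

theorem theorem3p2 (d m n : ℕ) (hn : 1 ≤ n)
    (D : Measure (EuclideanSpace ℝ (Fin d))) [IsProbabilityMeasure D]
    (p : EuclideanSpace ℝ (Fin d)) (hD : BalancedAbout D p) :
    (1 - 1 / 2 ^ (n - 1) * ∑ k ∈ Finset.range d, ((n - 1).choose k : ℝ)) ^ m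
        ≤ (equiPartitionLaw m n D).real {x | IsTverberg x} ∧
      (equiPartitionLaw m n D).real {x | IsTverberg x}
        ≤ (2 * (1 - 1 / 2 ^ n) ^ m - (1 - 1 / 2 ^ (n - 1)) ^ m) ^ d := by
  unfold equiPartitionLaw
  have hm := measurable_radialProj p
  obtain ⟨hne, hsymm⟩ := hD.map_radialProj
  set μ := D.map (radialProj p) with hμ
  have : IsProbabilityMeasure μ := Measure.isProbabilityMeasure_map hm.aemeasurable
  have hpres : MeasurePreserving (fun (x : Fin m × Fin n → EuclideanSpace ℝ (Fin d)) i =>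
      radialProj p (x i)) (Measure.pi fun _ => D) (Measure.pi fun _ => μ) :=
    measurePreserving_pi _ _ fun _ => ⟨hm, rfl⟩
  constructor
  · let A : Set (Fin n → EuclideanSpace ℝ (Fin d)) := {x | ∃ w, ∀ j, 0 < inner ℝ (x j) w}
    have hA : MeasurableSet A := by
      have : A = posSolvable (fun _ : Fin n => LinearMap.id) ⊤ Finset.univ := by
        ext x; simp [A, posSolvable]
      rw [this]
      exact (isOpen_posSolvable _ _ _).measurableSet
    have h1 := measureReal_pi_forall_curry_mem (α := Fin m) μ Aᶜ
    rw [probReal_compl_eq_one_sub hA, measureReal_exists_forall_inner_pos hn hne hsymm,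
      finrank_euclideanSpace_fin, Fintype.card_fin] at h1
    have h2 : MeasurableSet {x : Fin m × Fin n → EuclideanSpace ℝ (Fin d) |
        ∀ a, (fun k => x (a, k)) ∈ Aᶜ} := measurableSet_forall_curry_mem hA.compl
    rw [← h1, ← hpres.measureReal_preimage h2.nullMeasurableSet]
    refine measureReal_mono fun x hx => ?_
    exact ⟨p, Set.mem_iInter.2 fun c => mem_convexHull_of_not_exists_inner_pos (hx c)⟩
  · refine le_trans ?_ (measureReal_stdGaussian_compl_exists_separatedOn_le d m hn)
    have hmeas : MeasurableSet {x : Fin m × Fin n → EuclideanSpace ℝ (Fin d) |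
        ∃ S : Finset (Fin m), S.Nonempty ∧ SeparatedOn x S} :=
      isOpen_setOf_exists_separatedOn.measurableSet
    rw [probReal_compl_eq_one_sub hmeas, measureReal_exists_separatedOn_congr
      ae_stdGaussian_inner_ne_zero map_neg_stdGaussian hne hsymm,
      ← probReal_compl_eq_one_sub hmeas, ← hpres.measureReal_preimage hmeas.compl.nullMeasurableSet]
    refine measureReal_mono fun x hx => ?_
    rintro ⟨S, hS, h⟩
    exact not_nonempty_iInter_convexHull_of_separatedOn hS h hx
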